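/- All spaces are $T_1$. A space $X$ satisfies well-ordered $(F)$ if there is a family $\mathcal W=\{\mathcal W(x):x\in X\}$ such that each $\mathcal W(x)$ is a collection of subsets of $X$ containing $x$ which is well-ordered under reverse inclusion, and such that whenever $x$ belongs to an open set $U$, there is an open set $V=V(x,U)$ containing $x$ such that for every $y\in V$ there is $W\in\mathcal W(y)$ with $x\in W\subseteq U$. A space locally satisfies well-ordered $(F)$ if every point has a neighborhood that satisfies well-ordered $(F)$ as a subspace. A space is paracompact if it is Hausdorff and every open cover has a locally finite open refinement that covers the space. **Theorem.** A ($T_1$) space satisfies well-ordered $(F)$ if and only if it is paracompact and locally satisfies well-ordered $(F)$. -/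

import Mathlib

open Topology

/-- `W = {W x : x ∈ X}` satisfies condition (F): each `W x` consists of subsets of `X` containing
`x`, and whenever `x` belongs to an open set `U` there is an open `V ∋ x` such that for every
`y ∈ V` some `A ∈ W y` satisfies `x ∈ A ⊆ U`. -/
def ConditionF {X : Type*} [TopologicalSpace X] (W : X → Set (Set X)) : Prop :=
  (∀ x, ∀ A ∈ W x, x ∈ A) ∧
    ∀ x, ∀ U : Set X, IsOpen U → x ∈ U →
      ∃ V : Set X, IsOpen V ∧ x ∈ V ∧ ∀ y ∈ V, ∃ A ∈ W y, x ∈ A ∧ A ⊆ U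

/-- The space `X` satisfies well-ordered (F): it has a family `W` satisfying condition (F) such that
each `W x` is well-ordered by reverse inclusion (`A` strictly precedes `B` iff `B ⊂ A`). -/
def WellOrderedF (X : Type*) [TopologicalSpace X] : Prop :=
  ∃ W : X → Set (Set X), ConditionF W ∧
    ∀ x, IsWellOrder (W x) (fun A B => (B : Set X) ⊂ (A : Set X))

/-- The space `X` locally satisfies well-ordered (F): every point has a neighborhood which, with
the subspace topology, satisfies well-ordered (F). -/
def LocallyWellOrderedF (X : Type*) [TopologicalSpace X] : Prop :=
  ∀ x : X, ∃ N ∈ 𝓝 x, WellOrderedF N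

universe u

/-! Given an open cover, send each point `y` to an index `j` with the largest member of `W y` lying
in some cover element contained in `U j`; the fibres form a cushioned refinement. By Michael's
argument, cushioned refinements yield normality and paracompactness. Conversely, paracompactness
gives a locally finite closed cover inside open pieces carrying local families, and each point uses
the family of one piece whose closed set contains it. -/

theorem isWellOrder_ssuperset_iff {X : Type*} (𝒜 : Set (Set X)) :
    IsWellOrder 𝒜 (fun A B => (B : Set X) ⊂ (A : Set X)) ↔
      ∀ 𝒮 ⊆ 𝒜, 𝒮.Nonempty → ∃ A ∈ 𝒮, ∀ B ∈ 𝒮, B ⊆ A := by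
  constructor
  · intro h 𝒮 h𝒮 hne
    obtain ⟨B, hB⟩ := hne
    obtain ⟨A, hA, hmin⟩ := h.wf.has_min {A : 𝒜 | (A : Set X) ∈ 𝒮} ⟨⟨B, h𝒮 hB⟩, hB⟩
    refine ⟨A, hA, fun B hB => ?_⟩
    have h₁ := hmin ⟨B, h𝒮 hB⟩ hB
    rcases trichotomous_of (fun A B : 𝒜 => (B : Set X) ⊂ (A : Set X)) A ⟨B, h𝒮 hB⟩ with h₂ | h₂ | h₂
    · exact h₂.subset
    · rw [h₂]
    · exact absurd h₂ h₁
  · intro h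
    have hwf : WellFounded (fun A B : 𝒜 => (B : Set X) ⊂ (A : Set X)) := by
      refine WellFounded.wellFounded_iff_has_min.2 fun S hS => ?_
      obtain ⟨_, ⟨A, hA, rfl⟩, hmax⟩ := h (Subtype.val '' S)
        (by rintro _ ⟨A, -, rfl⟩; exact A.2) (hS.image _)
      exact ⟨A, hA, fun B hB hAB => hAB.not_subset (hmax B ⟨B, hB, rfl⟩)⟩
    refine { wf := hwf, trichotomous := fun A B hAB hBA => ?_ }
    obtain ⟨C, hC, hmax⟩ := h {(A : Set X), (B : Set X)}
      (by rintro _ (rfl | rfl); exacts [A.2, B.2]) ⟨A, Or.inl rfl⟩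
    have hA := hmax A (Or.inl rfl)
    have hB := hmax B (Or.inr rfl)
    rcases hC with rfl | rfl
    · by_contra hne
      exact hAB (hB.ssubset_of_ne fun e => hne (Subtype.ext e.symm))
    · by_contra hne
      exact hBA (hA.ssubset_of_ne fun e => hne (Subtype.ext e))

/-- Strict inclusions may collapse under `g`, but largest members of subfamilies survive. -/
theorem isWellOrder_ssuperset_image {X Y : Type*} {𝒜 : Set (Set X)} {g : Set X → Set Y}
    (hg : Monotone g) (h : IsWellOrder 𝒜 (fun A B => (B : Set X) ⊂ (A : Set X))) :
    IsWellOrder (g '' 𝒜) (fun A B => (B : Set Y) ⊂ (A : Set Y)) := by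
  rw [isWellOrder_ssuperset_iff] at h ⊢
  rintro 𝒮 h𝒮 ⟨B, hB⟩
  obtain ⟨B, hB', rfl⟩ := h𝒮 hB
  obtain ⟨A, hA, hmax⟩ := h (𝒜 ∩ g ⁻¹' 𝒮) Set.inter_subset_left ⟨B, hB', hB⟩
  refine ⟨g A, hA.2, fun C hC => ?_⟩
  obtain ⟨C, hC', rfl⟩ := h𝒮 hC
  exact hg (hmax C ⟨hC', hC⟩)

theorem WellOrderedF.of_isInducing {X Y : Type*} [TopologicalSpace X] [TopologicalSpace Y]
    {f : Y → X} (hf : IsInducing f) (h : WellOrderedF X) : WellOrderedF Y := by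
  obtain ⟨W, ⟨hmem, hF⟩, hwo⟩ := h
  refine ⟨fun y => Set.preimage f '' W (f y), ⟨?_, ?_⟩, fun y =>
    isWellOrder_ssuperset_image (fun _ _ => Set.preimage_mono) (hwo (f y))⟩
  · rintro y _ ⟨A, hA, rfl⟩
    exact hmem _ A hA
  · intro y U hU hy
    obtain ⟨U, hU', rfl⟩ := hf.isOpen_iff.1 hU
    obtain ⟨V, hV, hyV, h⟩ := hF (f y) U hU' hy
    refine ⟨f ⁻¹' V, hV.preimage hf.continuous, hyV, fun z hz => ?_⟩
    obtain ⟨A, hA, hyA, hAU⟩ := h (f z) hz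
    exact ⟨_, ⟨A, hA, rfl⟩, hyA, Set.preimage_mono hAU⟩

/-! ### Cushioned covers -/

/-- A family `C` covers the space and is cushioned in the family `U`. -/
def IsCushionedCover {X ι : Type*} [TopologicalSpace X] (C U : ι → Set X) : Prop :=
  (∀ x, ∃ i, x ∈ C i) ∧ ∀ J : Set ι, closure (⋃ j ∈ J, C j) ⊆ ⋃ j ∈ J, U j

theorem IsCushionedCover.mono {X ι : Type*} [TopologicalSpace X] {C U U' : ι → Set X}
    (h : IsCushionedCover C U) (hU : ∀ i, U i ⊆ U' i) : IsCushionedCover C U' :=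
  ⟨h.1, fun J => (h.2 J).trans (Set.iUnion₂_mono fun i _ => hU i)⟩

theorem IsCushionedCover.closure_subset {X ι : Type*} [TopologicalSpace X] {C U : ι → Set X}
    (h : IsCushionedCover C U) (i : ι) : closure (C i) ⊆ U i := by
  simpa using h.2 {i}

theorem IsCushionedCover.subset {X ι : Type*} [TopologicalSpace X] {C U : ι → Set X}
    (h : IsCushionedCover C U) (i : ι) : C i ⊆ U i :=
  subset_closure.trans (h.closure_subset i)

theorem WellOrderedF.exists_isCushionedCover {X ι : Type*} [TopologicalSpace X]
    (h : WellOrderedF X) (U : ι → Set X) (hU : ∀ i, IsOpen (U i)) (hcov : ∀ x, ∃ i, x ∈ U i) :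
    ∃ C : ι → Set X, IsCushionedCover C U := by
  obtain ⟨W, ⟨hmem, hF⟩, hwo⟩ := h
  choose i hi using hcov
  choose V hV hxV hVW using fun x => hF x (U (i x)) (hU _) (hi x)
  have hmax : ∀ y, ∃ A ∈ W y, (∃ j, A ⊆ U j) ∧ ∀ B ∈ W y, (∃ j, B ⊆ U j) → B ⊆ A := by
    intro y
    obtain ⟨A, hA, -, hAU⟩ := hVW y y (hxV y)
    obtain ⟨B, hB, hmax⟩ := (isWellOrder_ssuperset_iff _).1 (hwo y) {A ∈ W y | ∃ j, A ⊆ U j}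
      (Set.sep_subset _ _) ⟨A, hA, _, hAU⟩
    exact ⟨B, hB.1, hB.2, fun C hC hCU => hmax C ⟨hC, hCU⟩⟩
  choose A hA hAU hAmax using hmax
  choose j hj using hAU
  refine ⟨fun k => {y | j y = k}, fun x => ⟨j x, rfl⟩, fun J x hx => ?_⟩
  -- Some `B ∈ W y` contains `x` and fits in a cover element, so maximality puts `x` in `A y ⊆ U (j
  -- y)`.
  obtain ⟨y, hyV, hy⟩ := mem_closure_iff.1 hx (V x) (hV x) (hxV x)
  obtain ⟨B, hB, hxB, hBU⟩ := hVW x y hyV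
  simp only [Set.mem_iUnion, Set.mem_ofPred_eq, exists_prop, exists_eq_right'] at hy ⊢
  exact ⟨j y, hy, hj y (hAmax y B hB ⟨_, hBU⟩ hxB)⟩

/-! ### From cushioned refinements to paracompactness -/

/-- Every open cover, indexed in the universe of the space, has a cushioned refinement. -/
def CushionedRefinable (X : Type u) [TopologicalSpace X] : Prop :=
  ∀ (ι : Type u) (U : ι → Set X), (∀ i, IsOpen (U i)) → (∀ x, ∃ i, x ∈ U i) →
    ∃ C : ι → Set X, IsCushionedCover C U

theorem CushionedRefinable.exists_closed_shrinking {X : Type u} [TopologicalSpace X]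
    (h : CushionedRefinable X) {ι : Type} (U : ι → Set X) (hU : ∀ i, IsOpen (U i))
    (hcov : ∀ x, ∃ i, x ∈ U i) :
    ∃ K : ι → Set X, (∀ i, IsClosed (K i)) ∧ (∀ i, K i ⊆ U i) ∧ ∀ x, ∃ i, x ∈ K i := by
  obtain ⟨C, hC⟩ := h (ULift.{u} ι) (fun i => U i.down) (fun i => hU _)
    fun x => (hcov x).imp' ULift.up fun _ => id
  exact ⟨fun i => closure (C ⟨i⟩), fun i => isClosed_closure, fun i => hC.closure_subset ⟨i⟩,
    fun x => (hC.1 x).imp' ULift.down fun _ hx => subset_closure hx⟩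

theorem CushionedRefinable.normalSpace {X : Type u} [TopologicalSpace X]
    (h : CushionedRefinable X) : NormalSpace X := by
  refine ⟨fun A B hA hB hAB => ?_⟩
  obtain ⟨K, hK, hKU, hcov⟩ := h.exists_closed_shrinking (fun b : Bool => cond b Aᶜ Bᶜ)
    (by rintro (_ | _); exacts [hB.isOpen_compl, hA.isOpen_compl]) (fun x => by
      by_cases hx : x ∈ A
      · exact ⟨false, Set.disjoint_left.1 hAB hx⟩
      · exact ⟨true, hx⟩)
  refine ⟨(K true)ᶜ, (K false)ᶜ, (hK _).isOpen_compl, (hK _).isOpen_compl,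
    Set.subset_compl_comm.1 (hKU true), Set.subset_compl_comm.1 (hKU false), ?_⟩
  rw [Set.disjoint_left]
  intro x hx hx'
  obtain ⟨_ | _, hb⟩ := hcov x
  exacts [hx' hb, hx hb]

/-- Well-order the indices and iterate: each cushioned cover refines `U` with the closure of the
earlier pieces of the previous cover removed. Points outside the closure of all pieces but the
`i`-th form `V n i`. -/
theorem CushionedRefinable.exists_sigma_disjoint {X : Type u} [TopologicalSpace X]
    (h : CushionedRefinable X) {ι : Type u} (U : ι → Set X) (hU : ∀ i, IsOpen (U i))
    (hcov : ∀ x, ∃ i, x ∈ U i) :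
    ∃ V : ℕ → ι → Set X, (∀ n i, IsOpen (V n i)) ∧ (∀ n i, V n i ⊆ U i) ∧
      (∀ n i j, (V n i ∩ V n j).Nonempty → i = j) ∧ ∀ x, ∃ n i, x ∈ V n i := by
  obtain ⟨_, _⟩ := exists_wellFoundedLT ι
  have step : ∀ C : {C : ι → Set X // IsCushionedCover C U},
      ∃ C' : {C : ι → Set X // IsCushionedCover C U},
        IsCushionedCover C'.1 (fun i => U i \ closure (⋃ j ∈ Set.Iio i, C.1 j)) := by
    rintro ⟨C, hC⟩
    obtain ⟨C', hC'⟩ := h ι (fun i => U i \ closure (⋃ j ∈ Set.Iio i, C j))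
      (fun i => (hU i).sdiff isClosed_closure) (fun x => by
        -- The least `i` works: the removed closure is cushioned in the `U j` with `j < i`.
        obtain ⟨i, hi, hmin⟩ := wellFounded_lt.has_min {i | x ∈ U i} (hcov x)
        refine ⟨i, hi, fun hx => ?_⟩
        obtain ⟨j, hj, hxj⟩ := Set.mem_iUnion₂.1 (hC.2 _ hx)
        exact hmin j hxj hj)
    exact ⟨⟨C', hC'.mono fun i => Set.sdiff_subset⟩, hC'⟩
  choose next hnext using step
  obtain ⟨C₀, hC₀⟩ := h ι U hU hcov
  let D : ℕ → {C : ι → Set X // IsCushionedCover C U} := fun n => next^[n] ⟨C₀, hC₀⟩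
  have hD : ∀ n, IsCushionedCover (D (n + 1)).1
      (fun i => U i \ closure (⋃ j ∈ Set.Iio i, (D n).1 j)) := by
    intro n
    simp only [D, Function.iterate_succ_apply']
    exact hnext _
  have hsub : ∀ n i, (closure (⋃ j ∈ {j | j ≠ i}, (D n).1 j))ᶜ ⊆ (D n).1 i := by
    intro n i x hx
    obtain ⟨j, hj⟩ := (D n).2.1 x
    by_cases hij : j = i
    · exact hij ▸ hj
    · exact absurd (subset_closure (Set.mem_biUnion hij hj)) hx
  refine ⟨fun n i => (closure (⋃ j ∈ {j | j ≠ i}, (D n).1 j))ᶜ,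
    fun n i => isClosed_closure.isOpen_compl, fun n i => (hsub n i).trans ((D n).2.subset i),
    fun n i j => ?_, fun x => ?_⟩
  · rintro ⟨x, hi, hj⟩
    by_contra hij
    exact hj (subset_closure (Set.mem_biUnion hij (hsub n i hi)))
  -- With `i` least over all stages, stage `n + 2` rules out smaller indices at stage `n + 1`, and
  -- `x ∈ (D n).1 i` rules out larger ones.
  · obtain ⟨i, ⟨n, hn⟩, hmin⟩ := wellFounded_lt.has_min {i | ∃ n, x ∈ (D n).1 i}
      (((D 0).2.1 x).imp fun i hi => ⟨0, hi⟩)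
    refine ⟨n + 1, i, fun hx => ?_⟩
    have hsplit : (⋃ j ∈ {j | j ≠ i}, (D (n + 1)).1 j) ⊆
        (⋃ j ∈ Set.Iio i, (D (n + 1)).1 j) ∪ ⋃ j ∈ Set.Ioi i, (D (n + 1)).1 j := by
      intro y hy
      obtain ⟨j, hj, hy⟩ := Set.mem_iUnion₂.1 hy
      rcases lt_or_gt_of_ne hj with hj | hj
      · exact Or.inl (Set.mem_biUnion hj hy)
      · exact Or.inr (Set.mem_biUnion hj hy)
    have hx' := closure_mono hsplit hx
    rw [closure_union] at hx'
    rcases hx' with hx' | hx'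
    · obtain ⟨k, hk⟩ := (D (n + 2)).2.1 x
      have hik : i ≤ k := not_lt.1 (hmin k ⟨_, hk⟩)
      exact ((hD (n + 1)).subset k hk).2
        (closure_mono (Set.biUnion_mono (Set.Iio_subset_Iio hik) fun _ _ => subset_rfl) hx')
    · obtain ⟨k, hk, hxk⟩ := Set.mem_iUnion₂.1 ((hD n).2 _ hx')
      exact hxk.2 (subset_closure (Set.mem_biUnion (show i ∈ Set.Iio k from hk) hn))

theorem CushionedRefinable.paracompactSpace {X : Type u} [TopologicalSpace X]
    (h : CushionedRefinable X) : ParacompactSpace X := by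
  have := h.normalSpace
  refine ⟨fun ι U hU hcov => ?_⟩
  obtain ⟨V, hV, hVU, hdisj, hVcov⟩ := h.exists_sigma_disjoint U hU (Set.iUnion_eq_univ_iff.1 hcov)
  obtain ⟨K, hK, hKV, hKcov⟩ := h.exists_closed_shrinking (fun n => ⋃ i, V n i)
    (fun n => isOpen_iUnion (hV n)) (fun x => by simpa using hVcov x)
  choose G hG hKG hGV using fun n =>
    normal_exists_closure_subset (hK n) (isOpen_iUnion (hV n)) (hKV n)
  choose G' hG' hKG' hGG' using fun n => normal_exists_closure_subset (hK n) (hG n) (hKG n)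
  -- Removing `R n` leaves only levels `n ≤ k` meeting `G' k`; intersecting with `G n` makes each
  -- level locally finite.
  let R : ℕ → Set X := fun n => ⋃ m ∈ Set.Iio n, closure (G' m)
  refine ⟨ℕ × ι, fun p => (V p.1 p.2 ∩ G p.1) \ R p.1, ?_, ?_, ?_, ?_⟩
  · rintro ⟨n, i⟩
    exact ((hV n i).inter (hG n)).sdiff
      ((Set.finite_Iio n).isClosed_biUnion fun _ _ => isClosed_closure)
  · refine Set.iUnion_eq_univ_iff.2 fun x => ?_
    classical
    have hex : ∃ n, x ∈ G n := (hKcov x).imp fun n hn => hKG n hn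
    obtain ⟨i, hi⟩ := Set.mem_iUnion.1 (hGV _ (subset_closure (Nat.find_spec hex)))
    refine ⟨(Nat.find hex, i), ⟨hi, Nat.find_spec hex⟩, fun hx => ?_⟩
    obtain ⟨m, hm, hxm⟩ := Set.mem_iUnion₂.1 hx
    exact Nat.find_min hex hm (hGG' m hxm)
  · intro x
    obtain ⟨k, hk⟩ := hKcov x
    have hloc : ∀ n, ∃ T ∈ 𝓝 x, {i | (V n i ∩ G n ∩ T).Nonempty}.Finite := by
      intro n
      by_cases hx : x ∈ closure (G n)
      · obtain ⟨i, hi⟩ := Set.mem_iUnion.1 (hGV n hx)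
        refine ⟨V n i, (hV n i).mem_nhds hi, (Set.finite_singleton i).subset ?_⟩
        rintro j ⟨y, hy, hy'⟩
        exact hdisj n j i ⟨y, hy.1, hy'⟩
      · refine ⟨_, isClosed_closure.isOpen_compl.mem_nhds hx, Set.finite_empty.subset ?_⟩
        rintro j ⟨y, hy, hy'⟩
        exact hy' (subset_closure hy.2)
    choose T hT hTfin using hloc
    refine ⟨G' k ∩ ⋂ n ∈ Set.Iic k, T n, Filter.inter_mem ((hG' k).mem_nhds (hKG' k hk))
      ((Filter.biInter_mem (Set.finite_Iic k)).2 fun n _ => hT n), ?_⟩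
    refine ((Set.finite_Iic k).biUnion fun n _ => (hTfin n).image (Prod.mk n)).subset ?_
    rintro ⟨n, i⟩ ⟨y, ⟨hyV, hyR⟩, hyG, hyT⟩
    have hn : n ≤ k := by
      by_contra! hn
      exact hyR (Set.mem_biUnion (show k ∈ Set.Iio n from hn) (subset_closure hyG))
    exact Set.mem_biUnion (show n ∈ Set.Iic k from hn)
      ⟨i, ⟨y, hyV, Set.mem_iInter₂.1 hyT n hn⟩, rfl⟩
  · rintro ⟨n, i⟩
    exact ⟨i, fun x hx => hVU n i hx.1.1⟩

/-! ### Gluing local families -/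

theorem WellOrderedF.of_locallyFinite {X ι : Type*} [TopologicalSpace X] {O F : ι → Set X}
    (hO : ∀ i, IsOpen (O i)) (hF : ∀ i, IsClosed (F i)) (hFO : ∀ i, F i ⊆ O i)
    (hlf : LocallyFinite F) (hcov : ∀ x, ∃ i, x ∈ F i) (h : ∀ i, WellOrderedF (O i)) :
    WellOrderedF X := by
  choose W hW hwo using h
  choose i hi using hcov
  refine ⟨fun y => Set.image Subtype.val '' W (i y) ⟨y, hFO _ (hi y)⟩, ⟨?_, ?_⟩, fun y =>
    isWellOrder_ssuperset_image (fun _ _ => Set.image_mono) (hwo _ _)⟩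
  · rintro y _ ⟨A, hA, rfl⟩
    exact ⟨_, (hW _).1 _ A hA, rfl⟩
  · intro x U hU hx
    have hloc : ∀ k, ∃ V : Set X, IsOpen V ∧ x ∈ V ∧ (x ∈ F k → ∀ y ∈ V, ∃ hy : y ∈ O k,
        ∃ A ∈ W k ⟨y, hy⟩, x ∈ Subtype.val '' A ∧ Subtype.val '' A ⊆ U) := by
      intro k
      by_cases hxk : x ∈ F k
      · obtain ⟨V, hV, hxV, hVW⟩ := (hW k).2 ⟨x, hFO k hxk⟩ (Subtype.val ⁻¹' U)
          (hU.preimage continuous_subtype_val) hx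
        refine ⟨Subtype.val '' V, (hO k).isOpenMap_subtype_val V hV, ⟨_, hxV, rfl⟩, fun _ => ?_⟩
        rintro _ ⟨y, hy, rfl⟩
        obtain ⟨A, hA, hxA, hAU⟩ := hVW y hy
        exact ⟨y.2, A, hA, ⟨_, hxA, rfl⟩, Set.image_subset_iff.2 hAU⟩
      · exact ⟨Set.univ, isOpen_univ, trivial, fun h => absurd h hxk⟩
    choose V hV hxV hVW using hloc
    -- Avoiding every `F k` that misses `x` forces `x ∈ F (i y)` for nearby `y`, whichever index `i
    -- y` was chosen.
    have hnhds : (⋂ k ∈ {k | x ∈ F k}, V k) ∩ ⋂ k ∈ {k | x ∉ F k}, (F k)ᶜ ∈ 𝓝 x :=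
      Filter.inter_mem
        ((Filter.biInter_mem (hlf.point_finite x)).2 fun k _ => (hV k).mem_nhds (hxV k))
        (by simpa using hlf.iInter_compl_mem_nhds hF x)
    obtain ⟨T, hT, hTo, hxT⟩ := mem_nhds_iff.1 hnhds
    refine ⟨T, hTo, hxT, fun y hy => ?_⟩
    have hxF : x ∈ F (i y) := by
      by_contra hxF
      exact Set.mem_iInter₂.1 (hT hy).2 (i y) hxF (hi y)
    obtain ⟨_, A, hA, hxA, hAU⟩ := hVW (i y) hxF y (Set.mem_iInter₂.1 (hT hy).1 (i y) hxF)
    exact ⟨_, ⟨A, hA, rfl⟩, hxA, hAU⟩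

theorem LocallyWellOrderedF.wellOrderedF {X : Type*} [TopologicalSpace X] [T2Space X]
    [ParacompactSpace X] (h : LocallyWellOrderedF X) : WellOrderedF X := by
  choose N hN hwo using h
  obtain ⟨O, hO, hOcov, hlf, hON⟩ := precise_refinement (fun x => interior (N x))
    (fun _ => isOpen_interior)
    (Set.iUnion_eq_univ_iff.2 fun x => ⟨x, mem_interior_iff_mem_nhds.2 (hN x)⟩)
  obtain ⟨F, hFcov, hF, hFO⟩ := exists_iUnion_eq_closed_subset hO hlf.point_finite hOcov
  exact .of_locallyFinite hO hF hFO (hlf.subset hFO) (Set.iUnion_eq_univ_iff.1 hFcov) fun i =>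
    (hwo i).of_isInducing (IsEmbedding.inclusion ((hON i).trans interior_subset)).isInducing

theorem theorem3p2 (X : Type*) [TopologicalSpace X] [T1Space X] :
    WellOrderedF X ↔ (T2Space X ∧ ParacompactSpace X) ∧ LocallyWellOrderedF X := by
  constructor
  · intro h
    have hc : CushionedRefinable X := fun _ U hU hcov => h.exists_isCushionedCover U hU hcov
    have := hc.normalSpace
    have : T4Space X := {}
    exact ⟨⟨inferInstance, hc.paracompactSpace⟩,
      fun x => ⟨Set.univ, Filter.univ_mem, h.of_isInducing IsInducing.subtypeVal⟩⟩
  · rintro ⟨⟨_, _⟩, h⟩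
    exact h.wellOrderedF
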